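/- A polymatroid is a pair $(E,f)$, where $E$ is a set and $f:\mathcal P(E)\to\mathbb R$ satisfies $f(\emptyset)=0$, is monotone, and is submodular: $f(A)+f(B)\ge f(A\cup B)+f(A\cap B)$. It is of finite type if $f(A)=\sup\{f(F): F\subseteq A\text{ finite}\}$ for all $A\subseteq E$. We write $f(x_1,\dots,x_k)=f(\{x_1,\dots,x_k\})$ and $\mathrm{cl}(A)=\{x\in E: f(A\cup\{x\})=f(A)\}$. The polymatroid is entropic if there are random variables $(X_x)_{x\in E}$ on a finite probability space such that, for every $A\subseteq E$, $f(A)$ is the Shannon entropy (in bits) of the tuple $(X_x)_{x\in A}$. A polymatroid of finite type is almost entropic if it is the pointwise limit of a sequence of entropic polymatroids on $E$. A partial Dowling geometry (PDG) of rank $r$ is a triple $(E,f,S)$, where $(E,f)$ is a polymatroid and $S$ is a set with an involution $s\mapsto s^{-1}$ and a distinguished element $e=e^{-1}$, such that: 1. $E$ contains a set $B=\{b_1,\dots,b_r\}$ of $r$ elements with $f(A)=|A|$ for all $A\subseteq B$. 2. $E$ is the disjoint union of $B$ and of copies $\{s_{i,j}: s\in S\}$ of $S$, one for each pair $1\le i<j\le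 r$. For $i<j$ one sets $s_{j,i}:=(s^{-1})_{i,j}$. 3. $s_{i,j}\in\mathrm{cl}(\{b_i,b_j\})$ for all $s\in S$ and all distinct $i,j$. 4. $f(s_{i,j})=1$ and $f(b_i,s_{i,j})=2$ for all $s\in S$ and all distinct $i,j$. 5. $f(s_{i,j},(s^{-1})_{j,k},e_{k,i})=2$ for all $s\in S$ and all distinct $i,j,k$. A triple $(s,s',s'')\in S^3$ is a relator of the PDG if $f(s_{i,j},s'_{j,k},s''_{k,i})=2$ for all distinct $1\le i,j,k\le r$. **Lemma.** Let $(E,f,S)$ be an almost entropic PDG of rank $4$ (that is, $(E,f)$ is almost entropic), and let $s,s',s''\in S$. If there exist distinct indices $1\le p,q,r\le 4$ with $f(s_{p,q},s'_{q,r},s''_{r,p})=2$, then $(s,s',s'')$ is a relator of $(E,f,S)$; that is, $f(s_{i,j},s'_{j,k},s''_{k,i})=2$ for all distinct $1\le i,j,k\le 4$. -/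

import Mathlib

/-- The polymatroid axioms for a rank function `f` on the ground set `E`. -/
structure IsPolymatroid {E : Type*} (f : Set E → ℝ) : Prop where
  empty : f ∅ = 0
  mono : ∀ A B : Set E, A ⊆ B → f A ≤ f B
  submodular : ∀ A B : Set E, f (A ∪ B) + f (A ∩ B) ≤ f A + f B

/-- `f` is of finite type: the value on a set is the supremum of the values on its finite
subsets. (For finite `E` this follows from monotonicity.) -/
def IsFiniteType {E : Type*} (f : Set E → ℝ) : Prop :=
  ∀ A : Set E, IsLUB {x : ℝ | ∃ F : Set E, F.Finite ∧ F ⊆ A ∧ x = f F} (f A)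

/-- The closure operator of a polymatroid. -/
def polyClosure {E : Type*} (f : Set E → ℝ) (A : Set E) : Set E :=
  {x | f A = f (A ∪ {x})}

/-- Shannon entropy, in bits, of a random variable `X` on the finite probability space `(Ω, P)`.
Here `P.map X` is the distribution of `X`; all but finitely many terms vanish, and a term with
`P (X = x) = 0` is `0`. -/
noncomputable def shannonEntropy {Ω : Type*} [Finite Ω] {α : Type*} (P : PMF Ω) (X : Ω → α) : ℝ :=
  ∑' x : α, (P.map X x).toReal * Real.logb 2 (1 / (P.map X x).toReal)

/-- `h` is entropic: there are a finite probability space and random variables `X i`, `i : E`, on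
it with `h A` the entropy of the tuple `(X i)_{i ∈ A}`, for every `A`. -/
def IsEntropic {E : Type*} (h : Set E → ℝ) : Prop :=
  ∃ (Ω : Type) (_ : Finite Ω) (P : PMF Ω) (codom : E → Type) (X : ∀ i : E, Ω → codom i),
    ∀ A : Set E, h A = shannonEntropy P (fun (ω : Ω) (i : A) => X i ω)

/-- An almost entropic polymatroid: a polymatroid of finite type that is a pointwise limit of
entropic polymatroids on the same ground set. -/
structure IsAlmostEntropic {E : Type*} (f : Set E → ℝ) : Prop where
  isPolymatroid : IsPolymatroid f
  isFiniteType : IsFiniteType f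
  exists_entropic_seq : ∃ h : ℕ → Set E → ℝ, (∀ n, IsEntropic (h n)) ∧
    ∀ A : Set E, Filter.Tendsto (fun n => h n A) Filter.atTop (nhds (f A))

/-- A (coherent) partial Dowling geometry of rank `r` with ground set `E` and generating set `S`.
The element `s_{i,j}` is `elt i j s`; only the values with `i ≠ j` are meaningful. -/
structure PartialDowlingGeometry (r : ℕ) (E S : Type*) where
  /-- the rank function -/
  f : Set E → ℝ
  isPolymatroid : IsPolymatroid f
  /-- the involution on the generating set -/
  inv : S → S
  inv_involutive : Function.Involutive inv
  /-- the distinguished element of the generating set -/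
  e : S
  inv_e : inv e = e
  /-- the distinguished basis -/
  b : Fin r → E
  rank_basis : ∀ A : Finset (Fin r), f (b '' (A : Set (Fin r))) = (A.card : ℝ)
  /-- the copies of the generating set -/
  elt : Fin r → Fin r → S → E
  /-- `E` is the disjoint union of the distinguished basis and of the copies
  `{s_{i,j} | s ∈ S}` of `S`, over all `i < j`. -/
  partition : Function.Bijective
    (Sum.elim b (fun x : {p : Fin r × Fin r // p.1 < p.2} × S => elt x.1.1.1 x.1.1.2 x.2))
  /-- the convention `s_{j,i} = (s⁻¹)_{i,j}` -/
  elt_swap : ∀ i j : Fin r, i < j → ∀ s : S, elt j i s = elt i j (inv s)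
  frame : ∀ i j : Fin r, i ≠ j → ∀ s : S, elt i j s ∈ polyClosure f {b i, b j}
  rank_elt : ∀ i j : Fin r, i ≠ j → ∀ s : S, f {elt i j s} = 1
  rank_basis_elt : ∀ i j : Fin r, i ≠ j → ∀ s : S, f {b i, elt i j s} = 2
  coherence : ∀ i j k : Fin r, i ≠ j → j ≠ k → k ≠ i → ∀ s : S,
    f {elt i j s, elt j k (inv s), elt k i e} = 2

/-- `(s, s', s'')` is a relator: `f (s_{i,j}, s'_{j,k}, s''_{k,i}) = 2` for all distinct
indices `i, j, k`. -/
def PartialDowlingGeometry.IsRelator {r : ℕ} {E S : Type*} (D : PartialDowlingGeometry r E S)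
    (s s' s'' : S) : Prop :=
  ∀ i j k : Fin r, i ≠ j → j ≠ k → k ≠ i → D.f {D.elt i j s, D.elt j k s', D.elt k i s''} = 2

/-! A collinear triple on the triangle `i, j, k` is projected from the point `e_{k,l}`. By
coherence, the plane spanned by the triple and `e_{k,l}` also contains `s'_{j,l}` and `s''_{l,i}`.
It meets the plane of `b_i, b_j, b_l` in rank at most 3 + 3 - 4 = 2, and the triple on `i, j, l`
lies in both (`rank_eq_two_of_replace`). Thus one index can be exchanged for the fourth; with a
spare index always available, such exchanges reach every ordered triple. -/

/-- Inclusions replace exact unions and intersections, so no intersection of explicit sets has to be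
computed. -/
theorem IsPolymatroid.le_add {E : Type*} {f : Set E → ℝ} (hf : IsPolymatroid f)
    {A B C U : Set E} (hU : U ⊆ A ∪ B) (hC : C ⊆ A ∩ B) : f U + f C ≤ f A + f B := by
  linarith [hf.submodular A B, hf.mono _ _ hU, hf.mono _ _ hC]

theorem IsPolymatroid.le_add_of_subset {E : Type*} {f : Set E → ℝ} (hf : IsPolymatroid f)
    {A B U : Set E} (hU : U ⊆ A ∪ B) : f U ≤ f A + f B := by
  linarith [hf.le_add hU (Set.empty_subset _), hf.empty]

namespace PartialDowlingGeometry

variable {r : ℕ} {E S : Type*} (D : PartialDowlingGeometry r E S)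

theorem elt_symm {i j : Fin r} (hij : i ≠ j) (s : S) : D.elt j i s = D.elt i j (D.inv s) := by
  rcases lt_or_gt_of_ne hij with h | h
  · exact D.elt_swap i j h s
  · rw [D.elt_swap j i h, D.inv_involutive]

theorem rank_basis_elt' {i j : Fin r} (hij : i ≠ j) (s : S) : D.f {D.b j, D.elt i j s} = 2 := by
  rw [D.elt_symm hij.symm]
  exact D.rank_basis_elt j i hij.symm _

theorem rank_frame_elt {i j : Fin r} (hij : i ≠ j) (s : S) :
    D.f {D.b i, D.b j, D.elt i j s} = 2 := by
  have h : D.f {D.b i, D.b j} = D.f ({D.b i, D.b j} ∪ {D.elt i j s}) := D.frame i j hij s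
  have h2 := D.rank_basis {i, j}
  rw [Finset.card_pair hij, Finset.coe_pair, Set.image_pair] at h2
  rw [show ({D.b i, D.b j, D.elt i j s} : Set E) = {D.b i, D.b j} ∪ {D.elt i j s} by
    ext; simp; tauto, ← h, h2]
  norm_num

theorem rank_singleton (i : Fin r) : D.f {D.b i} = 1 := by
  simpa using D.rank_basis {i}

theorem rank_triple {i j k : Fin r} (hij : i ≠ j) (hjk : j ≠ k) (hki : k ≠ i) :
    D.f {D.b i, D.b j, D.b k} = 3 := by
  have h := D.rank_basis {i, j, k}
  rw [Finset.card_eq_three.2 ⟨i, j, k, hij, hki.symm, hjk, rfl⟩] at h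
  simpa [Set.image_insert_eq] using h

/-- Two elements on distinct lines of the frame through a common point are independent. -/
theorem two_le_rank_pair {i j k : Fin r} (hij : i ≠ j) (hjk : j ≠ k) (hki : k ≠ i) (s t : S) :
    2 ≤ D.f {D.elt i j s, D.elt j k t} := by
  have hf := D.isPolymatroid
  -- Together with `b_j` the two elements span `b_i` and `b_k`, hence rank 3; removing `b_j` costs
  -- at most 1.
  have h1 : D.f {D.b i, D.b j, D.elt i j s, D.elt j k t} + D.f {D.b j, D.elt i j s} ≤
      D.f {D.b i, D.b j, D.elt i j s} + D.f {D.b j, D.elt i j s, D.elt j k t} :=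
    hf.le_add (by simp [Set.insert_subset_iff]) (by simp [Set.insert_subset_iff])
  have h2 : D.f {D.b i, D.b j, D.b k} + D.f {D.b j, D.elt j k t} ≤
      D.f {D.b j, D.b k, D.elt j k t} + D.f {D.b i, D.b j, D.elt i j s, D.elt j k t} :=
    hf.le_add (by simp [Set.insert_subset_iff]) (by simp [Set.insert_subset_iff])
  have h3 : D.f {D.b j, D.elt i j s, D.elt j k t} ≤
      D.f {D.b j} + D.f {D.elt i j s, D.elt j k t} :=
    hf.le_add_of_subset (by simp [Set.insert_subset_iff])
  linarith [D.rank_triple hij hjk hki, D.rank_singleton j, D.rank_frame_elt hij s,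
    D.rank_frame_elt hjk t, D.rank_basis_elt j k hjk t, D.rank_basis_elt' hij s]

/-- Three elements on the three lines of a frame triangle lie in the plane of that triangle. -/
theorem rank_plane_le {i j k : Fin r} (hij : i ≠ j) (hjk : j ≠ k) (hki : k ≠ i) (s s' s'' : S) :
    D.f {D.b i, D.b j, D.b k, D.elt i j s, D.elt j k s', D.elt k i s''} ≤ 3 := by
  have hf := D.isPolymatroid
  have pair {a b : Fin r} (hab : a ≠ b) : D.f {D.b a, D.b b} = 2 := by
    have h := D.rank_basis {a, b}
    rw [Finset.card_pair hab] at h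
    simpa [Set.image_insert_eq] using h
  -- Each added element lies in the closure of two basis elements already present, so the rank stays
  -- 3.
  have h1 : D.f {D.b i, D.b j, D.b k, D.elt i j s} + D.f {D.b i, D.b j} ≤
      D.f {D.b i, D.b j, D.b k} + D.f {D.b i, D.b j, D.elt i j s} :=
    hf.le_add (by simp [Set.insert_subset_iff]) (by simp [Set.insert_subset_iff])
  have h2 : D.f {D.b i, D.b j, D.b k, D.elt i j s, D.elt j k s'} + D.f {D.b j, D.b k} ≤
      D.f {D.b i, D.b j, D.b k, D.elt i j s} + D.f {D.b j, D.b k, D.elt j k s'} :=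
    hf.le_add (by simp [Set.insert_subset_iff]) (by simp [Set.insert_subset_iff])
  have h3 : D.f {D.b i, D.b j, D.b k, D.elt i j s, D.elt j k s', D.elt k i s''} +
      D.f {D.b k, D.b i} ≤
      D.f {D.b i, D.b j, D.b k, D.elt i j s, D.elt j k s'} + D.f {D.b k, D.b i, D.elt k i s''} :=
    hf.le_add (by simp [Set.insert_subset_iff]) (by simp [Set.insert_subset_iff])
  linarith [pair hij, pair hjk, pair hki, D.rank_triple hij hjk hki, D.rank_frame_elt hij s,
    D.rank_frame_elt hjk s', D.rank_frame_elt hki s'']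

/-- Projecting a collinear triple from `e_{k,l}` replaces the index `k` by `l`. -/
theorem rank_eq_two_of_replace {i j k l : Fin r} (hij : i ≠ j) (hjk : j ≠ k) (hki : k ≠ i)
    (hil : i ≠ l) (hjl : j ≠ l) (hkl : k ≠ l) {s s' s'' : S}
    (h : D.f {D.elt i j s, D.elt j k s', D.elt k i s''} = 2) :
    D.f {D.elt i j s, D.elt j l s', D.elt l i s''} = 2 := by
  have hf := D.isPolymatroid
  have c1 : D.f {D.elt j k s', D.elt k l D.e, D.elt j l s'} = 2 := by
    have := D.coherence l j k hjl.symm hjk hkl (D.inv s')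
    rw [← D.elt_symm hjl.symm, D.inv_involutive] at this
    rw [← this]; congr 1; grind
  have c2 : D.f {D.elt l k D.e, D.elt k i s'', D.elt l i s''} = 2 := by
    have := D.coherence k i l hki hil hkl.symm s''
    rw [← D.elt_symm hil] at this
    rw [← this]; congr 1; grind
  -- Since `e` is its own inverse, both coherence lines pass through the same centre of projection.
  have he : D.elt l k D.e = D.elt k l D.e := by rw [D.elt_symm hkl, D.inv_e]
  rw [he] at c2
  -- Each coherence line is spanned by two points already in the plane, so its third point adds no
  -- rank.
  have p1 := D.two_le_rank_pair hjk hkl hjl.symm s' D.e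
  have p2 := D.two_le_rank_pair hkl.symm hki hil D.e s''
  rw [he] at p2
  -- the plane spanned by the given triple and `e_{k,l}`
  have a0 : D.f {D.elt i j s, D.elt j k s', D.elt k i s'', D.elt k l D.e} ≤
      D.f {D.elt i j s, D.elt j k s', D.elt k i s''} + D.f {D.elt k l D.e} :=
    hf.le_add_of_subset (by simp [Set.insert_subset_iff])
  have a1 : D.f {D.elt i j s, D.elt j k s', D.elt k i s'', D.elt k l D.e, D.elt j l s'} +
      D.f {D.elt j k s', D.elt k l D.e} ≤
      D.f {D.elt i j s, D.elt j k s', D.elt k i s'', D.elt k l D.e} +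
      D.f {D.elt j k s', D.elt k l D.e, D.elt j l s'} :=
    hf.le_add (by simp [Set.insert_subset_iff]) (by simp [Set.insert_subset_iff])
  have a2 : D.f {D.elt i j s, D.elt j k s', D.elt k i s'', D.elt k l D.e, D.elt j l s',
        D.elt l i s''} + D.f {D.elt k l D.e, D.elt k i s''} ≤
      D.f {D.elt i j s, D.elt j k s', D.elt k i s'', D.elt k l D.e, D.elt j l s'} +
      D.f {D.elt k l D.e, D.elt k i s'', D.elt l i s''} :=
    hf.le_add (by simp [Set.insert_subset_iff]) (by simp [Set.insert_subset_iff])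
  -- this plane and the plane of the target triangle together have rank four
  have u1 : D.f {D.b i, D.b j, D.b k, D.b l} + D.f {D.b l, D.elt k l D.e} ≤
      D.f {D.b k, D.b l, D.elt k l D.e} + D.f {D.b i, D.b j, D.b l, D.elt k l D.e} :=
    hf.le_add (by simp [Set.insert_subset_iff]) (by simp [Set.insert_subset_iff])
  have u2 : D.f {D.b i, D.b j, D.b k, D.b l} = 4 := by
    have h := D.rank_basis {i, j, k, l}
    rw [show Finset.card {i, j, k, l} = 4 by grind] at h
    simpa [Set.image_insert_eq] using h
  have u3 : D.f {D.b i, D.b j, D.b l, D.elt k l D.e} +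
      D.f {D.elt i j s, D.elt j l s', D.elt l i s''} ≤
      D.f {D.elt i j s, D.elt j k s', D.elt k i s'', D.elt k l D.e, D.elt j l s',
        D.elt l i s''} +
      D.f {D.b i, D.b j, D.b l, D.elt i j s, D.elt j l s', D.elt l i s''} :=
    hf.le_add (by simp [Set.insert_subset_iff]) (by simp [Set.insert_subset_iff])
  have lower : D.f {D.elt i j s, D.elt j l s'} ≤
      D.f {D.elt i j s, D.elt j l s', D.elt l i s''} :=
    hf.mono _ _ (by simp [Set.insert_subset_iff])
  apply le_antisymm
  · linarith [D.rank_elt k l hkl D.e, D.rank_plane_le hij hjl hil.symm s s' s'',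
      D.rank_basis_elt' hkl D.e, D.rank_frame_elt hkl D.e]
  · linarith [D.two_le_rank_pair hij hjl hil.symm s s']

end PartialDowlingGeometry

theorem mainTheorem7 {E S : Type*} (D : PartialDowlingGeometry 4 E S)
    (hD : IsAlmostEntropic D.f) (s s' s'' : S)
    (h : ∃ p q r : Fin 4, p ≠ q ∧ q ≠ r ∧ r ≠ p ∧
      D.f {D.elt p q s, D.elt q r s', D.elt r p s''} = 2) :
    D.IsRelator s s' s'' := by
  let R (i j k : Fin 4) : Prop := D.f {D.elt i j s, D.elt j k s', D.elt k i s''} = 2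
  have third {i j k l : Fin 4} (hij : i ≠ j) (hjk : j ≠ k) (hki : k ≠ i) (hil : i ≠ l)
      (hjl : j ≠ l) (h : R i j k) : R i j l := by
    by_cases hkl : k = l
    · exact hkl ▸ h
    · exact D.rank_eq_two_of_replace hij hjk hki hil hjl hkl h
  have rot (a b c : E) : ({a, b, c} : Set E) = {b, c, a} := by grind
  -- Projection changes only the last index; cycling the triple brings the other positions there.
  have first {i j k l : Fin 4} (hij : i ≠ j) (hjk : j ≠ k) (hki : k ≠ i) (hjl : j ≠ l)
      (hkl : k ≠ l) (h : R i j k) : R l j k := by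
    by_cases hil : i = l
    · exact hil ▸ h
    · have h' := D.rank_eq_two_of_replace hjk hki hij hjl hkl hil
        ((congrArg D.f (rot _ _ _)).symm.trans h)
      rwa [← rot] at h'
  have second {i j k l : Fin 4} (hij : i ≠ j) (hjk : j ≠ k) (hki : k ≠ i) (hil : i ≠ l)
      (hkl : k ≠ l) (h : R i j k) : R i l k := by
    by_cases hjl : j = l
    · exact hjl ▸ h
    · have h' := D.rank_eq_two_of_replace hki hij hjk hkl hil hjl
        ((congrArg D.f (rot _ _ _)).trans h)
      rwa [rot] at h'
  obtain ⟨p, q, r, hpq, hqr, hrp, h0⟩ := h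
  have unused (a b c : Fin 4) : ∃ t, a ≠ t ∧ b ≠ t ∧ c ≠ t := by
    revert a b c; decide
  intro i j k hij hjk hki
  -- If `i` occupies a later position, that position is first moved to the spare index `t`, freeing
  -- `i` for the first one.
  obtain ⟨q, r, hiq, hqr, hri, h1⟩ : ∃ q r, i ≠ q ∧ q ≠ r ∧ r ≠ i ∧ R i q r := by
    obtain ⟨t, hpt, hqt, hrt⟩ := unused p q r
    by_cases hqi : q = i
    · subst hqi
      exact ⟨t, r, hqt, hrt.symm, hqr.symm, first hpt hrt.symm hrp hqt.symm hqr.symm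
        (second hpq hqr hrp hpt hrt h0)⟩
    · by_cases hri : r = i
      · subst hri
        exact ⟨q, t, hqr.symm, hqt, hrt.symm, first hpq hqt hpt.symm hqr hrt.symm
          (third hpq hqr hrp hpt hqt h0)⟩
      · exact ⟨q, r, Ne.symm hqi, hqr, hri, first hpq hqr hrp hqi hri h0⟩
  -- The same manoeuvre places `j` second while `i` stays fixed.
  obtain ⟨r, hjr, hri, h2⟩ : ∃ r, j ≠ r ∧ r ≠ i ∧ R i j r := by
    obtain ⟨t, hit, hqt, hrt⟩ := unused i q r
    by_cases hrj : r = j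
    · subst hrj
      exact ⟨t, hrt, hit.symm, second hiq hqt hit.symm hij hrt.symm
        (third hiq hqr hri hit hqt h1)⟩
    · exact ⟨r, Ne.symm hrj, hri, second hiq hqr hri hij hrj h1⟩
  exact third hij hjr hri hki.symm hjk h2
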